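/- **Graphs.** A graph $\Gamma=(V,l,E)$ from $\{x_1,\dots,x_m\}$ to $\{y_1,\dots,y_n\}$ ($m,n\ge 0$) consists of the vertex set $V=\{x_1,\dots,x_m\}\sqcup\{y_1,\dots,y_n\}\sqcup G$ with $G$ finite (the $x_i$ and $y_j$ are called argument places), a sign function $l$ from the argument places to $\{1,-1\}$, and a set $E$ of unordered pairs of distinct vertices (edges), such that, with respect to the connected components of $(V,E)$: (1) every vertex belongs to an edge; (2) $\{x_i,x_j\}\in E$ iff $l(x_i)=-l(x_j)$ and $x_i,x_j$ are in the same component, and likewise for $\{y_i,y_j\}$; (3) $\{x_i,y_j\}\in E$ iff $l(x_i)=l(y_j)$ and $x_i,y_j$ are in the same component; (4) a component that includes an edge between two argument places contains no element of $G$, and any other component contains exactly one element $g$ of $G$, and all its other vertices are joined to $g$. **g-dinaturality.** Let $\Gamma$ be such data $(V,l,E)$ (conditions (1)–(4) are not needed here) with set of components $K$ and classifier $\pi:V\to K$. Let $\mathcal A$ be a category, $\mathcal A^{1}=\mathcal A$, $\mathcal A^{-1}=\mathcal A^{op}$, and let $T:\prod_i\mathcal A^{l(x_i)}\to\mathcal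 A$ and $S:\prod_j\mathcal A^{l(y_j)}\to\mathcal A$ be functors. A family of morphisms $\alpha(X):T(X_{\pi(x_1)},\dots,X_{\pi(x_m)})\to S(X_{\pi(y_1)},\dots,X_{\pi(y_n)})$, indexed by all families $X=(X_k)_{k\in K}$ of objects of $\mathcal A$, is g-dinatural with the graph $\Gamma$ if for every $k\in K$, all $X,Y$ that agree outside $k$, and every $f:X_k\to Y_k$ (completed by identities in the other components), $$S\langle 1_Y,f\rangle\circ\alpha(Y)\circ T\langle f,1_Y\rangle=S\langle f,1_X\rangle\circ\alpha(X)\circ T\langle 1_X,f\rangle ,$$ where in $T\langle u,v\rangle$ the argument place $w$ is occupied by $u_{\pi(w)}$ if $l(w)=1$ and by $v_{\pi(w)}$ if $l(w)=-1$. **Amalgamation and composition.** Let $\Phi$ be a graph from $\{x_1,\dots,x_m\}$ to $\{y_1,\dots,y_n\}$ and $\Psi$ a graph from $\{y_1,\dots,y_n\}$ to $\{z_1,\dots,z_p\}$ with the same signs on the $y_j$ and with $G_\Phi\cap G_\Psi=\emptyset$. The amalgamation $\Phi+\Psi$ has the vertices $V_\Phi\cup V_\Psi$ and the disjoint union of $E_\Phi$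 and $E_\Psi$ as its edges. The composite $\Psi\Phi$ has one component for each component $K$ of $\Phi+\Psi$. If, for some sign $s$, all $x_i\in K$ have sign $s$ and all $z_j\in K$ have sign $-s$ (there may be no $x_i$ or no $z_j$ in $K$), this component consists of the $x_i,z_j\in K$ and a new vertex $g$, with all of these $x_i,z_j$ joined to $g$ and no other edges. Otherwise it consists of the $x_i,z_j\in K$, where two $x$'s, or two $z$'s, are joined iff their signs are opposite, and an $x$ and a $z$ are joined iff their signs are equal. For families $\alpha:T\to S$ and $\beta:S\to R$ of the types given by $\Phi$ and $\Psi$, the composite $\beta\alpha:T\to R$ is the family indexed by families $X$ of objects indexed by the components of $\Psi\Phi$, with $(\beta\alpha)(X)=\beta(X'')\circ\alpha(X')$, where $X'$ and $X''$ give to each component of $\Phi$, respectively $\Psi$, the object that $X$ gives to the component of $\Phi+\Psi$ which contains it. (If $\Phi+\Psi$ has a single component, this is $(\beta\alpha)(A)=\beta(A,\dots,A)\circ\alpha(A,\dots,A)$.) One says that $\Phi+\Psi$ *provides g-dinaturality* if for every category $\mathcal A$, all functors $T,S,R$ as above, every $\alpha:T\to S$ g-dinatural with the graph $\Phi$ and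 every $\beta:S\to R$ g-dinatural with the graph $\Psi$, the composite $\beta\alpha$ is g-dinatural with the graph $\Psi\Phi$. An *alternating loop* in $\Phi+\Psi$ is a sequence of vertices $v_1,\dots,v_q$ ($q\ge 2$) with $v_1=v_q$ together with edges $e_i=\{v_i,v_{i+1}\}$ ($1\le i<q$) of $\Phi+\Psi$ such that of any two consecutive edges $e_i,e_{i+1}$ one belongs to $E_\Phi$ and the other to $E_\Psi$. **Theorem 2.2.** Let $\Phi$ and $\Psi$ be graphs as above, whose amalgamation $\Phi+\Psi$ may have any number of components (in particular, a single one). Then $\Phi+\Psi$ provides g-dinaturality if and only if $\Phi+\Psi$ contains no alternating loop. -/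

import Mathlib

open CategoryTheory

universe v u

namespace GDinat

/-! ### Graphs

The sign of an argument place is a `Bool`: `true` stands for `1` (covariant, positive) and `false`
for `-1` (contravariant, negative). -/

/-- The vertices of a graph: `m` left-hand side argument places, `n` right-hand side argument
places, and the elements of a set `G`. -/
inductive Vertex (m n : ℕ) (G : Type) : Type
  | left (i : Fin m)
  | right (j : Fin n)
  | inner (g : G)

/-- The data `(V, l, E)`: a finite set `G` and a set `E` of (unordered, proper) pairs of vertices.
The two restrictions `a`, `b` of the sign function `l` are parameters. The conditions that make
these data a graph in the sense of the theory are in `SignedGraph.IsGraph`. -/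
structure SignedGraph {m n : ℕ} (a : Fin m → Bool) (b : Fin n → Bool) where
  G : Type
  finite_G : Finite G
  E : SimpleGraph (Vertex m n G)

namespace SignedGraph

variable {m n p : ℕ} {a : Fin m → Bool} {b : Fin n → Bool} {c : Fin p → Bool}

/-- The components. -/
abbrev Comp (Γ : SignedGraph a b) : Type := Γ.E.ConnectedComponent

/-- The component classifier `π`. -/
abbrev π (Γ : SignedGraph a b) (w : Vertex m n Γ.G) : Γ.Comp := Γ.E.connectedComponentMk w

/-- The five conditions in the definition of a graph. -/
structure IsGraph (Γ : SignedGraph a b) : Prop where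
  /-- Every vertex belongs to some edge. -/
  exists_adj : ∀ w, ∃ w', Γ.E.Adj w w'
  left_left : ∀ i j, Γ.E.Adj (.left i) (.left j) ↔
    (a i ≠ a j ∧ Γ.π (.left i) = Γ.π (.left j))
  right_right : ∀ i j, Γ.E.Adj (.right i) (.right j) ↔
    (b i ≠ b j ∧ Γ.π (.right i) = Γ.π (.right j))
  left_right : ∀ i j, Γ.E.Adj (.left i) (.right j) ↔
    (a i = b j ∧ Γ.π (.left i) = Γ.π (.right j))
  /-- A component that includes an edge between two argument places contains no element of `G`. -/
  not_inner : ∀ k : Γ.Comp,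
    (∃ w w', Γ.π w = k ∧ Γ.E.Adj w w' ∧ (∀ g, w ≠ .inner g) ∧ ∀ g, w' ≠ .inner g) →
      ∀ g, Γ.π (.inner g) ≠ k
  /-- Any other component contains exactly one element `g` of `G`, and all its other vertices are
  joined to `g`. -/
  inner : ∀ k : Γ.Comp,
    (¬ ∃ w w', Γ.π w = k ∧ Γ.E.Adj w w' ∧ (∀ g, w ≠ .inner g) ∧ ∀ g, w' ≠ .inner g) →
      ∃ g, (∀ g', Γ.π (.inner g') = k ↔ g' = g) ∧
        ∀ w, Γ.π w = k → w ≠ .inner g → Γ.E.Adj w (.inner g)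

end SignedGraph

/-! ### Amalgamation -/

/-- The vertices of an amalgamation: the union of the vertex sets of the two graphs, in which the
right-hand side argument places `y` of the first are the left-hand side ones of the second. -/
inductive AmalgVertex (m n p : ℕ) (G H : Type) : Type
  | x (i : Fin m)
  | y (j : Fin n)
  | z (k : Fin p)
  | fst (g : G)
  | snd (h : H)

/-- The vertices of the first graph, as vertices of the amalgamation. -/
def inFst {m n p : ℕ} {G H : Type} : Vertex m n G ↪ AmalgVertex m n p G H where
  toFun
    | .left i => .x i
    | .right j => .y j
    | .inner g => .fst g
  inj' := by rintro (_ | _ | _) (_ | _ | _) h <;> simp_all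

/-- The vertices of the second graph, as vertices of the amalgamation. -/
def inSnd {m n p : ℕ} {G H : Type} : Vertex n p H ↪ AmalgVertex m n p G H where
  toFun
    | .left j => .y j
    | .right k => .z k
    | .inner h => .snd h
  inj' := by rintro (_ | _ | _) (_ | _ | _) h <;> simp_all

section Amalgamation

variable {m n p : ℕ} {a : Fin m → Bool} {b : Fin n → Bool} {c : Fin p → Bool}
variable (Φ : SignedGraph a b) (Ψ : SignedGraph b c)

/-- The edges of the amalgamation `Φ + Ψ` form the disjoint union of the edges of `Φ` and of `Ψ`:
`edges Φ Ψ true` are the edges that come from `Φ`, and `edges Φ Ψ false` those that come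
from `Ψ`. -/
def edges : Bool → SimpleGraph (AmalgVertex m n p Φ.G Ψ.G)
  | true => Φ.E.map inFst
  | false => Ψ.E.map inSnd

/-- The adjacency relation of `Φ + Ψ`, irrespective of the graph that an edge comes from. -/
def amalg : SimpleGraph (AmalgVertex m n p Φ.G Ψ.G) := edges Φ Ψ true ⊔ edges Φ Ψ false

/-- The components of `Φ + Ψ`. -/
abbrev AmalgComp : Type := (amalg Φ Ψ).ConnectedComponent

/-- The component of `Φ + Ψ` in which a vertex lies. -/
abbrev cls (w : AmalgVertex m n p Φ.G Ψ.G) : AmalgComp Φ Ψ := (amalg Φ Ψ).connectedComponentMk w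

/-- `Φ + Ψ` contains an alternating loop: a sequence of vertices `w 0, …, w q` with `w 0 = w q`,
and of `q ≥ 1` edges joining consecutive vertices, such that of any two consecutive edges one
belongs to `Φ` and the other to `Ψ`. -/
def HasAlternatingLoop : Prop :=
  ∃ (q : ℕ) (w : ℕ → AmalgVertex m n p Φ.G Ψ.G) (side : ℕ → Bool), 1 ≤ q ∧
    (∀ i < q, (edges Φ Ψ (side i)).Adj (w i) (w (i + 1))) ∧
    (∀ i, i + 1 < q → side (i + 1) ≠ side i) ∧ w 0 = w q

/-! ### Composition of graphs -/

/-- In the component `K` of `Φ + Ψ`, all `x`'s have the same sign, which is opposite to the sign of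
all `z`'s (there may be no `x` or no `z` in `K`). -/
def IsSplit (K : AmalgComp Φ Ψ) : Prop :=
  ∃ s : Bool, (∀ i, cls Φ Ψ (.x i) = K → a i = s) ∧ (∀ k, cls Φ Ψ (.z k) = K → c k = !s)

/-- The adjacency relation of the composition `ΨΦ`. In a component `K` of `Φ + Ψ` that is split,
all `x`'s and `z`'s are joined to a new vertex `g` (and there are no other edges, for reasons of
sign). In a component that is not split, `x`'s of opposite sign, `z`'s of opposite sign, and an `x`
and a `z` of the same sign are joined. -/
def compAdj : Vertex m p {K : AmalgComp Φ Ψ // IsSplit Φ Ψ K} →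
    Vertex m p {K : AmalgComp Φ Ψ // IsSplit Φ Ψ K} → Prop
  | .left i, .left j => cls Φ Ψ (.x i) = cls Φ Ψ (.x j) ∧ a i ≠ a j
  | .left i, .right k => cls Φ Ψ (.x i) = cls Φ Ψ (.z k) ∧ a i = c k
  | .right k, .left i => cls Φ Ψ (.x i) = cls Φ Ψ (.z k) ∧ a i = c k
  | .right k, .right l => cls Φ Ψ (.z k) = cls Φ Ψ (.z l) ∧ c k ≠ c l
  | .left i, .inner g => cls Φ Ψ (.x i) = g.1
  | .inner g, .left i => cls Φ Ψ (.x i) = g.1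
  | .right k, .inner g => cls Φ Ψ (.z k) = g.1
  | .inner g, .right k => cls Φ Ψ (.z k) = g.1
  | .inner _, .inner _ => False

theorem finite_amalgVertex : Finite (AmalgVertex m n p Φ.G Ψ.G) := by
  have := Φ.finite_G
  have := Ψ.finite_G
  let f : Fin m ⊕ Fin n ⊕ Fin p ⊕ Φ.G ⊕ Ψ.G → AmalgVertex m n p Φ.G Ψ.G
    | .inl i => .x i
    | .inr (.inl j) => .y j
    | .inr (.inr (.inl k)) => .z k
    | .inr (.inr (.inr (.inl g))) => .fst g
    | .inr (.inr (.inr (.inr h))) => .snd h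
  refine Finite.of_surjective f ?_
  rintro (i | j | k | g | h)
  exacts [⟨.inl i, rfl⟩, ⟨.inr (.inl j), rfl⟩, ⟨.inr (.inr (.inl k)), rfl⟩,
    ⟨.inr (.inr (.inr (.inl g))), rfl⟩, ⟨.inr (.inr (.inr (.inr h))), rfl⟩]

/-- The composition `ΨΦ` of the graphs `Φ` and `Ψ`. -/
def comp : SignedGraph a c where
  G := {K : AmalgComp Φ Ψ // IsSplit Φ Ψ K}
  finite_G := by
    have := finite_amalgVertex Φ Ψ
    infer_instance
  E :=
    { Adj := compAdj Φ Ψ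
      symm := ⟨by rintro (i | i | i) (j | j | j) h <;> simp_all [compAdj, eq_comm]⟩
      loopless := ⟨by rintro (i | i | i) h <;> simp [compAdj] at h⟩ }

/-- The component of `Φ + Ψ` from which a vertex of `ΨΦ` arises. -/
def origin : Vertex m p (comp Φ Ψ).G → AmalgComp Φ Ψ
  | .left i => cls Φ Ψ (.x i)
  | .right k => cls Φ Ψ (.z k)
  | .inner g => g.1

theorem origin_surjective (K : AmalgComp Φ Ψ) : ∃ w, origin Φ Ψ w = K := by
  by_cases h : IsSplit Φ Ψ K
  · exact ⟨.inner ⟨K, h⟩, rfl⟩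
  · by_contra! hne
    exact h ⟨true, fun i hi => absurd hi (hne (.left i)), fun k hk => absurd hk (hne (.right k))⟩

theorem reachable_of_origin_eq (w w' : Vertex m p (comp Φ Ψ).G)
    (h : origin Φ Ψ w = origin Φ Ψ w') : (comp Φ Ψ).E.Reachable w w' := by
  by_cases hs : IsSplit Φ Ψ (origin Φ Ψ w)
  · have key : ∀ u : Vertex m p (comp Φ Ψ).G, origin Φ Ψ u = origin Φ Ψ w →
        (comp Φ Ψ).E.Reachable u (.inner ⟨origin Φ Ψ w, hs⟩) := by
      rintro (i | k | g) hu
      · have hadj : (comp Φ Ψ).E.Adj (.left i) (.inner ⟨origin Φ Ψ w, hs⟩) := hu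
        exact hadj.reachable
      · have hadj : (comp Φ Ψ).E.Adj (.right k) (.inner ⟨origin Φ Ψ w, hs⟩) := hu
        exact hadj.reachable
      · have : g = ⟨origin Φ Ψ w, hs⟩ := Subtype.ext hu
        rw [this]
    exact (key w rfl).trans (key w' h.symm).symm
  · let side : Vertex m p (comp Φ Ψ).G → Bool
      | .left i => a i
      | .right k => !c k
      | .inner _ => true
    have adj : ∀ u u' : Vertex m p (comp Φ Ψ).G, origin Φ Ψ u = origin Φ Ψ w →
        origin Φ Ψ u' = origin Φ Ψ w → side u ≠ side u' → (comp Φ Ψ).E.Adj u u' := by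
      rintro (i | k | g) (i' | k' | g') hu hu' hne
      · exact ⟨hu.trans hu'.symm, hne⟩
      · exact ⟨hu.trans hu'.symm, by simpa [side] using hne⟩
      · exact absurd (hu' ▸ g'.2) hs
      · exact ⟨hu'.trans hu.symm, by cases h1 : a i' <;> cases h2 : c k <;> simp_all [side]⟩
      · exact ⟨hu.trans hu'.symm, by simpa [side] using hne⟩
      · exact absurd (hu' ▸ g'.2) hs
      all_goals exact absurd (hu ▸ g.2) hs
    have ex : ∀ s : Bool, ∃ u, origin Φ Ψ u = origin Φ Ψ w ∧ side u ≠ s := by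
      intro s
      by_contra! hall
      refine hs ⟨s, fun i hi => hall (.left i) hi, fun k hk => ?_⟩
      have := hall (.right k) hk
      simp [side] at this
      simp [← this]
    by_cases hside : side w = side w'
    · obtain ⟨u, hu, hne⟩ := ex (side w)
      exact (adj w u rfl hu hne.symm).reachable.trans
        (adj u w' hu h.symm (hside ▸ hne)).reachable
    · exact (adj w w' rfl h.symm hside).reachable

/-- The vertices of `Φ + Ψ` are sent to the components of `ΨΦ`: an `x` or a `z` to its own component
in `ΨΦ`, any other vertex to the component of `ΨΦ` that arises from its component in `Φ + Ψ`. -/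
noncomputable def toCompVertex : AmalgVertex m n p Φ.G Ψ.G → (comp Φ Ψ).Comp
  | .x i => (comp Φ Ψ).π (.left i)
  | .z k => (comp Φ Ψ).π (.right k)
  | w => (comp Φ Ψ).π (origin_surjective Φ Ψ (cls Φ Ψ w)).choose

theorem toCompVertex_spec (w : AmalgVertex m n p Φ.G Ψ.G) :
    ∃ w', toCompVertex Φ Ψ w = (comp Φ Ψ).π w' ∧ origin Φ Ψ w' = cls Φ Ψ w := by
  rcases w with i | j | k | g | h
  · exact ⟨.left i, rfl, rfl⟩
  · exact ⟨_, rfl, (origin_surjective Φ Ψ _).choose_spec⟩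
  · exact ⟨.right k, rfl, rfl⟩
  · exact ⟨_, rfl, (origin_surjective Φ Ψ _).choose_spec⟩
  · exact ⟨_, rfl, (origin_surjective Φ Ψ _).choose_spec⟩

/-- The correspondence between the components of `Φ + Ψ` and those of `ΨΦ`. -/
noncomputable def toComp : AmalgComp Φ Ψ → (comp Φ Ψ).Comp :=
  Quot.lift (toCompVertex Φ Ψ) (by
    intro w₁ w₂ h
    obtain ⟨u₁, h₁, h₁'⟩ := toCompVertex_spec Φ Ψ w₁
    obtain ⟨u₂, h₂, h₂'⟩ := toCompVertex_spec Φ Ψ w₂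
    rw [h₁, h₂]
    refine SimpleGraph.ConnectedComponent.sound (reachable_of_origin_eq Φ Ψ _ _ ?_)
    rw [h₁', h₂']
    exact SimpleGraph.ConnectedComponent.sound h)

/-- The component of `Φ + Ψ`, read in `ΨΦ`, in which a component of `Φ` is contained. -/
noncomputable def compOfFst : Φ.Comp → (comp Φ Ψ).Comp := fun k =>
  toComp Φ Ψ (k.map ⟨inFst, fun h => Or.inl (SimpleGraph.map_adj_apply.2 h)⟩)

/-- The component of `Φ + Ψ`, read in `ΨΦ`, in which a component of `Ψ` is contained. -/
noncomputable def compOfSnd : Ψ.Comp → (comp Φ Ψ).Comp := fun k =>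
  toComp Φ Ψ (k.map ⟨inSnd, fun h => Or.inr (SimpleGraph.map_adj_apply.2 h)⟩)

end Amalgamation

/-! ### Functors of mixed variance and g-dinatural transformations -/

section Transformations

variable (A : Type u) [Category.{v} A]

/-- The category `A` for the sign `1`, its opposite for the sign `-1`. -/
def Var : Bool → Type u
  | true => A
  | false => Aᵒᵖ

instance : ∀ s : Bool, Category.{v} (Var A s)
  | true => inferInstanceAs (Category.{v} A)
  | false => inferInstanceAs (Category.{v} Aᵒᵖ)

variable {A}

/-- `X` in case of the sign `1`, `Y` in case of the sign `-1`. -/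
def Var.obj : (s : Bool) → A → A → Var A s
  | true, X, _ => X
  | false, _, Y => Opposite.op Y

/-- `f` in case of the sign `1`, `g` in case of the sign `-1`. -/
def Var.map : (s : Bool) → {X X' Y Y' : A} → (X ⟶ X') → (Y' ⟶ Y) →
    (Var.obj s X Y ⟶ Var.obj s X' Y')
  | true, _, _, _, _, f, _ => f
  | false, _, _, _, _, _, g => g.op

/-- Functors `A^{a 0} × ⋯ × A^{a (m-1)} ⥤ A`. -/
abbrev MFunctor (A : Type u) [Category.{v} A] {m : ℕ} (a : Fin m → Bool) :=
  (∀ i, Var A (a i)) ⥤ A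

namespace MFunctor

variable {m : ℕ} {a : Fin m → Bool}

/-- `T⟨X, Y⟩`, with `X i` in the `i`-th argument place if it is positive and `Y i` if it is
negative. -/
abbrev mobj (T : MFunctor A a) (X Y : Fin m → A) : A :=
  CategoryTheory.Functor.obj T (fun i => Var.obj (a i) (X i) (Y i))

/-- `T⟨f, g⟩`, with `f i` in the `i`-th argument place if it is positive and `g i` if it is
negative. -/
abbrev mmap (T : MFunctor A a) {X X' Y Y' : Fin m → A} (f : ∀ i, X i ⟶ X' i)
    (g : ∀ i, Y' i ⟶ Y i) : T.mobj X Y ⟶ T.mobj X' Y' :=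
  CategoryTheory.Functor.map T (X := fun i => Var.obj (a i) (X i) (Y i))
    (Y := fun i => Var.obj (a i) (X' i) (Y' i)) (fun i => Var.map (a i) (f i) (g i))

end MFunctor

variable {m n p : ℕ} {a : Fin m → Bool} {b : Fin n → Bool} {c : Fin p → Bool}

/-- Transformations from `T` to `S` of the type given by `Γ`: families of morphisms
`T(X_{π(x₁)}, …, X_{π(xₘ)}) ⟶ S(X_{π(y₁)}, …, X_{π(yₙ)})` indexed by the families `X` of objects
indexed by the components of `Γ`. -/
abbrev Transf (Γ : SignedGraph a b) (T : MFunctor A a) (S : MFunctor A b) :=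
  ∀ X : Γ.Comp → A,
    T.mobj (fun i => X (Γ.π (.left i))) (fun i => X (Γ.π (.left i))) ⟶
      S.mobj (fun j => X (Γ.π (.right j))) (fun j => X (Γ.π (.right j)))

/-- The transformation `α` from `T` to `S` is g-dinatural with the graph `Γ`: for every component
`k`, for all families `X`, `Y` of objects that agree outside `k`, and for every morphism
`X k ⟶ Y k` (completed by identities outside `k` to a family `f`), the hexagon
`T⟨X, Y⟩ ⟶ S⟨Y, X⟩` commutes. -/
def IsGDinatural (Γ : SignedGraph a b) (T : MFunctor A a) (S : MFunctor A b)
    (α : Transf Γ T S) : Prop :=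
  ∀ (k : Γ.Comp) (X Y : Γ.Comp → A) (f : ∀ j, X j ⟶ Y j),
    (∀ j, j ≠ k → ∃ h : X j = Y j, f j = eqToHom h) →
    T.mmap (fun i => f (Γ.π (.left i))) (fun i => 𝟙 (Y (Γ.π (.left i)))) ≫ α Y ≫
        S.mmap (fun j => 𝟙 (Y (Γ.π (.right j)))) (fun j => f (Γ.π (.right j))) =
      T.mmap (fun i => 𝟙 (X (Γ.π (.left i)))) (fun i => f (Γ.π (.left i))) ≫ α X ≫
        S.mmap (fun j => f (Γ.π (.right j))) (fun j => 𝟙 (X (Γ.π (.right j))))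

/-- The composition `βα`: the family indexed by families `X` of objects indexed by the components
of `ΨΦ`, in which `α` and `β` take as argument, in each of their components, the object which `X`
gives to the component of `ΨΦ` that this component belongs to. If there is just one component, this
is the family of the `β(X, …, X) α(X, …, X)`. -/
noncomputable def compTransf (Φ : SignedGraph a b) (Ψ : SignedGraph b c) {T : MFunctor A a}
    {S : MFunctor A b} {R : MFunctor A c} (α : Transf Φ T S) (β : Transf Ψ S R) :
    Transf (comp Φ Ψ) T R :=
  fun X => CategoryStruct.comp (Y := S.mobj _ _)
    (α (fun k => X (compOfFst Φ Ψ k))) (β (fun k => X (compOfSnd Φ Ψ k)))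

end Transformations

/-- `Φ + Ψ` provides g-dinaturality: in every category, the composition of g-dinatural
transformations with the graphs `Φ` and `Ψ` is g-dinatural with the graph `ΨΦ`. -/
def ProvidesGDinaturality {m n p : ℕ} {a : Fin m → Bool} {b : Fin n → Bool} {c : Fin p → Bool}
    (Φ : SignedGraph a b) (Ψ : SignedGraph b c) : Prop :=
  ∀ (A : Type u) [Category.{v} A] (F : MFunctor A a) (G : MFunctor A b) (H : MFunctor A c)
    (γ : Transf Φ F G) (δ : Transf Ψ G H),
    IsGDinatural Φ F G γ → IsGDinatural Ψ G H δ →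
      IsGDinatural (comp Φ Ψ) F H (compTransf Φ Ψ γ δ)

end GDinat

/-! Make the components of `Φ` and of `Ψ` the nodes of a bipartite directed graph. Each argument
place `y` lies in one component of either side and gives an arc between them, directed by its sign
(`Precedes`). Inside a component two `y`'s are adjacent iff their signs are opposite, so an
alternating walk passes through components of alternating sides by `y`'s of alternating signs, and
all its arcs point the same way. Alternating loops therefore amount to directed cycles
(`hasAlternatingLoop_of_precedes`, `exists_precedes_of_hasAlternatingLoop`).

Without cycles, let every component of `Φ` and `Ψ` carry a stage, 0 for the source of the given
morphisms and 1 for their target. A stage assignment defines a composite when each `y` allows the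
passage from its `Φ`-component to its `Ψ`-component; this says that stages do not increase along
arcs. All stages 0 gives one side of the hexagon, all stages 1 the other. Raising a minimal
component of stage 0 keeps the assignment admissible, and g-dinaturality of `α` or `β` in that
component leaves the composite unchanged (`composite_eq_last`).

Given a cycle, take sets and functions. The middle functor records whether inhabitation passes from
negative to positive `y`'s within each component of `Φ`. Along the cycle this carries inhabitation
of the target at a component `l` of `Ψ` back to the source at `l`, so the truth value "the object at
`l` is nonempty" is g-dinatural out of this functor. On the diagonal the condition is void, and the
composite would force an empty object and a nonempty one to have the same truth value. -/

namespace GDinat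

/-! ### Alternating loops and directed cycles of components -/

section Loops

variable {m n p : ℕ} {a : Fin m → Bool} {b : Fin n → Bool} {c : Fin p → Bool}
variable {Φ : SignedGraph a b} {Ψ : SignedGraph b c}

/-- The vertex `w` of `Φ + Ψ` lies in the given component of `Φ` or of `Ψ`. -/
def Mem : Φ.Comp ⊕ Ψ.Comp → AmalgVertex m n p Φ.G Ψ.G → Prop
  | .inl k, w => ∃ v, inFst v = w ∧ Φ.π v = k
  | .inr l, w => ∃ v, inSnd v = w ∧ Ψ.π v = l

theorem Mem.unique {u u' : Φ.Comp ⊕ Ψ.Comp} {w : AmalgVertex m n p Φ.G Ψ.G}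
    (h : Mem u w) (h' : Mem u' w) (hs : u.isLeft = u'.isLeft) : u = u' := by
  rcases u with k | k <;> rcases u' with l | l <;> simp at hs
  all_goals
    obtain ⟨v, rfl, rfl⟩ := h
    obtain ⟨v', h1, rfl⟩ := h'
  · rw [inFst.injective h1]
  · rw [inSnd.injective h1]

theorem mem_inl_y {k : Φ.Comp} {j : Fin n} :
    Mem (Ψ := Ψ) (.inl k) (.y j) ↔ Φ.π (.right j) = k := by
  constructor
  · rintro ⟨v, h, rfl⟩
    rw [inFst.injective (a₂ := .right j) h]
  · intro h
    exact ⟨_, rfl, h⟩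

theorem mem_inr_y {l : Ψ.Comp} {j : Fin n} :
    Mem (Φ := Φ) (.inr l) (.y j) ↔ Ψ.π (.left j) = l := by
  constructor
  · rintro ⟨v, h, rfl⟩
    rw [inSnd.injective (a₂ := .left j) h]
  · intro h
    exact ⟨_, rfl, h⟩

theorem exists_eq_y {k : Φ.Comp} {l : Ψ.Comp} {w : AmalgVertex m n p Φ.G Ψ.G}
    (h : Mem (.inl k) w) (h' : Mem (.inr l) w) : ∃ j, w = .y j := by
  obtain ⟨_ | _ | _, rfl, -⟩ := h <;> obtain ⟨_ | _ | _, h, -⟩ := h' <;>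
    first | exact ⟨_, rfl⟩ | cases h

theorem exists_eq_y_of_ne {u u' : Φ.Comp ⊕ Ψ.Comp} {w : AmalgVertex m n p Φ.G Ψ.G}
    (h : Mem u w) (h' : Mem u' w) (hs : u.isLeft ≠ u'.isLeft) : ∃ j, w = .y j := by
  rcases u with k | k <;> rcases u' with l | l <;> simp at hs
  · exact exists_eq_y h h'
  · exact exists_eq_y h' h

theorem exists_mem_of_adj {s : Bool} {w w' : AmalgVertex m n p Φ.G Ψ.G}
    (h : (edges Φ Ψ s).Adj w w') :
    ∃ u : Φ.Comp ⊕ Ψ.Comp, u.isLeft = s ∧ Mem u w ∧ Mem u w' := by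
  cases s
  · obtain ⟨v, v', hv, rfl, rfl⟩ := (SimpleGraph.map_adj _ _ _ _).1 h
    exact ⟨.inr (Ψ.π v), rfl, ⟨v, rfl, rfl⟩, v', rfl,
      (SimpleGraph.ConnectedComponent.sound hv.reachable).symm⟩
  · obtain ⟨v, v', hv, rfl, rfl⟩ := (SimpleGraph.map_adj _ _ _ _).1 h
    exact ⟨.inl (Φ.π v), rfl, ⟨v, rfl, rfl⟩, v', rfl,
      (SimpleGraph.ConnectedComponent.sound hv.reachable).symm⟩

/-- The graph conditions enter the argument here, through the rule for argument places on the same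
side of a graph. -/
theorem edges_adj_y_iff (hΦ : Φ.IsGraph) (hΨ : Ψ.IsGraph) (s : Bool) (j j' : Fin n) :
    (edges Φ Ψ s).Adj (.y j) (.y j') ↔
      b j ≠ b j' ∧ ∃ u : Φ.Comp ⊕ Ψ.Comp, u.isLeft = s ∧ Mem u (.y j) ∧ Mem u (.y j') := by
  cases s
  · have : (edges Φ Ψ false).Adj (.y j) (.y j') ↔ Ψ.E.Adj (.left j) (.left j') :=
      SimpleGraph.map_adj_apply (f := inSnd) (a := .left j) (b := .left j')
    rw [this, hΨ.left_left]
    refine and_congr_right fun _ => ⟨fun h => ⟨.inr (Ψ.π (.left j)), rfl, ?_⟩, ?_⟩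
    · simp only [mem_inr_y]
      exact ⟨trivial, h.symm⟩
    · rintro ⟨k | l, h, h1, h2⟩ <;> simp at h
      exact (mem_inr_y.1 h1).trans (mem_inr_y.1 h2).symm
  · have : (edges Φ Ψ true).Adj (.y j) (.y j') ↔ Φ.E.Adj (.right j) (.right j') :=
      SimpleGraph.map_adj_apply (f := inFst) (a := .right j) (b := .right j')
    rw [this, hΦ.right_right]
    refine and_congr_right fun _ => ⟨fun h => ⟨.inl (Φ.π (.right j)), rfl, ?_⟩, ?_⟩
    · simp only [mem_inl_y]
      exact ⟨trivial, h.symm⟩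
    · rintro ⟨k | l, h, h1, h2⟩ <;> simp at h
      exact (mem_inl_y.1 h1).trans (mem_inl_y.1 h2).symm

/-- The components `u` and `v`, one of `Φ` and the other of `Ψ`, share an argument place `y`; the
sign of `y` tells whether this makes `u` precede `v`, or `v` precede `u`. The order is reversed when
`d` is negated. -/
def Precedes (d : Bool) (u v : Φ.Comp ⊕ Ψ.Comp) : Prop :=
  u.isLeft ≠ v.isLeft ∧ ∃ j, Mem u (.y j) ∧ Mem v (.y j) ∧ b j = (d ^^ v.isLeft)

theorem precedes_not {d : Bool} {u v : Φ.Comp ⊕ Ψ.Comp} (h : Precedes (!d) u v) :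
    Precedes d v u := by
  obtain ⟨hs, j, h1, h2, h3⟩ := h
  refine ⟨hs.symm, j, h2, h1, ?_⟩
  revert hs h3
  cases u.isLeft <;> cases v.isLeft <;> cases d <;> simp

theorem transGen_precedes_of_not {d : Bool} {u v : Φ.Comp ⊕ Ψ.Comp}
    (h : Relation.TransGen (Precedes (!d)) u v) : Relation.TransGen (Precedes d) v u :=
  by
  refine Relation.transGen_swap.1 ?_
  exact Relation.TransGen.mono (p := Function.swap (Precedes d)) (fun _ _ h => precedes_not h) _ _ h

/-- One step of an alternating walk; the Boolean is the side of the next edge. -/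
def AltStep (Φ : SignedGraph a b) (Ψ : SignedGraph b c)
    (x y : AmalgVertex m n p Φ.G Ψ.G × Bool) : Prop :=
  (edges Φ Ψ x.2).Adj x.1 y.1 ∧ y.2 = !x.2

theorem exists_walk_of_transGen {x y : AmalgVertex m n p Φ.G Ψ.G × Bool}
    (h : Relation.TransGen (AltStep Φ Ψ) x y) :
    ∃ (q : ℕ) (w : ℕ → AmalgVertex m n p Φ.G Ψ.G) (side : ℕ → Bool), 1 ≤ q ∧
      (∀ i < q, (edges Φ Ψ (side i)).Adj (w i) (w (i + 1))) ∧
      (∀ i, i + 1 < q → side (i + 1) ≠ side i) ∧ w 0 = x.1 ∧ side 0 = x.2 ∧ w q = y.1 := by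
  induction h using Relation.TransGen.head_induction_on with
  | @single x h =>
    refine ⟨1, fun i => if i = 0 then x.1 else y.1, fun _ => x.2, le_rfl, ?_, by simp, by simp⟩
    intro i hi
    obtain rfl : i = 0 := by omega
    exact h.1
  | @head x x' h _ ih =>
    obtain ⟨q, w, side, _, hadj, halt, hw, hs, hq⟩ := ih
    refine ⟨q + 1, fun i => i.casesOn x.1 w, fun i => i.casesOn x.2 side, by omega, ?_, ?_, rfl,
      rfl, hq⟩
    · rintro (_ | i) hi
      · simpa [hw] using h.1
      · exact hadj i (by omega)
    · rintro (_ | i) hi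
      · simp [hs, h.2]
      · exact halt i (by omega)

/-- The `y`'s of consecutive arcs lie in a common component and have opposite signs, hence are
adjacent there. The signs of the first and last `y` are recorded so that for `u = v` the walk can be
closed by an edge inside `u`. -/
theorem exists_altWalk_of_precedes (hΦ : Φ.IsGraph) (hΨ : Ψ.IsGraph) {d : Bool}
    {u v : Φ.Comp ⊕ Ψ.Comp} (h : Relation.TransGen (Precedes d) u v) :
    ∃ j j', Mem u (.y j) ∧ b j = (d ^^ !u.isLeft) ∧ Mem v (.y j') ∧ b j' = (d ^^ v.isLeft) ∧
      Relation.ReflTransGen (AltStep Φ Ψ) (.y j, !u.isLeft) (.y j', v.isLeft) := by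
  induction h with
  | single h =>
    obtain ⟨hs, j, h1, h2, h3⟩ := h
    have hs' := Bool.eq_not_of_ne hs.symm
    refine ⟨j, j, h1, by rw [h3, hs'], h2, h3, ?_⟩
    rw [hs']
  | @tail v₁ v₂ _ h ih =>
    obtain ⟨j, j', h1, h2, h3, h4, h5⟩ := ih
    obtain ⟨hs, i, i1, i2, i3⟩ := h
    have hs' := Bool.eq_not_of_ne hs.symm
    refine ⟨j, i, h1, h2, i2, i3, h5.tail ⟨?_, hs'⟩⟩
    refine (edges_adj_y_iff hΦ hΨ _ _ _).2 ⟨?_, _, rfl, h3, i1⟩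
    rw [h4, i3, hs']
    generalize Sum.isLeft v₁ = s
    cases d <;> cases s <;> simp

theorem hasAlternatingLoop_of_precedes (hΦ : Φ.IsGraph) (hΨ : Ψ.IsGraph) {d : Bool}
    {u : Φ.Comp ⊕ Ψ.Comp} (h : Relation.TransGen (Precedes d) u u) : HasAlternatingLoop Φ Ψ := by
  obtain ⟨j, j', h1, h2, h3, h4, h5⟩ := exists_altWalk_of_precedes hΦ hΨ h
  have hadj : (edges Φ Ψ u.isLeft).Adj (.y j') (.y j) := by
    refine (edges_adj_y_iff hΦ hΨ _ _ _).2 ⟨?_, u, rfl, h3, h1⟩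
    rw [h2, h4]
    generalize Sum.isLeft u = s
    cases d <;> cases s <;> simp
  obtain ⟨q, w, side, hq, hadj, halt, h0, -, h1⟩ :=
    exists_walk_of_transGen (Relation.TransGen.tail' h5
      (show AltStep Φ Ψ _ (.y j, !u.isLeft) from ⟨hadj, rfl⟩))
  exact ⟨q, w, side, hq, hadj, halt, h0.trans h1.symm⟩

theorem exists_precedes_of_hasAlternatingLoop (hΦ : Φ.IsGraph) (hΨ : Ψ.IsGraph)
    (h : HasAlternatingLoop Φ Ψ) (d : Bool) :
    ∃ u : Φ.Comp ⊕ Ψ.Comp, Relation.TransGen (Precedes d) u u := by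
  suffices ∃ (e : Bool) (u : Φ.Comp ⊕ Ψ.Comp), Relation.TransGen (Precedes e) u u by
    obtain ⟨e, u, hu⟩ := this
    obtain rfl | rfl := Bool.eq_or_eq_not e d
    · exact ⟨u, hu⟩
    · exact ⟨u, transGen_precedes_of_not hu⟩
  obtain ⟨q, w, side, hq, hadj, halt, hw⟩ := h
  have hq2 : q ≠ 1 := by
    rintro rfl
    exact (hadj 0 one_pos).ne hw
  have : Nonempty (Φ.Comp ⊕ Ψ.Comp) := ⟨(exists_mem_of_adj (hadj 0 hq)).choose⟩
  choose! N hN hN1 hN2 using fun i hi => exists_mem_of_adj (hadj i hi)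
  have hne : ∀ i, i + 1 < q → (N i).isLeft ≠ (N (i + 1)).isLeft := fun i hi => by
    rw [hN i (by omega), hN _ hi]
    exact (halt i hi).symm
  have hy : ∀ i, i + 1 < q → ∃ j, w (i + 1) = .y j := fun i hi =>
    exists_eq_y_of_ne (hN2 i (by omega)) (hN1 _ hi) (hne i hi)
  -- The first arc fixes the direction `e`; the alternation of signs and sides then forces it on all
  -- later arcs.
  obtain ⟨j₁, hj₁⟩ := hy 0 (by omega)
  obtain ⟨e, he⟩ : ∃ e, b j₁ = (e ^^ (N 1).isLeft) :=
    ⟨b j₁ ^^ (N 1).isLeft, by cases b j₁ <;> cases (N 1).isLeft <;> rfl⟩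
  have sign : ∀ {i : ℕ} {j j' : Fin n}, i < q → w i = .y j → w (i + 1) = .y j' → b j ≠ b j' := by
    intro i j j' hi h h'
    have := hadj i hi
    rw [h, h'] at this
    exact ((edges_adj_y_iff hΦ hΨ _ _ _).1 this).1
  have key : ∀ i, i + 1 < q → Relation.TransGen (Precedes e) (N 0) (N (i + 1)) ∧
      ∀ j, w (i + 1) = .y j → b j = (e ^^ (N (i + 1)).isLeft) := by
    intro i
    induction i with
    | zero =>
      intro hi
      have hm := hN2 0 (by omega)
      have hm' := hN1 1 hi
      rw [zero_add] at hm
      refine ⟨.single ⟨hne 0 hi, j₁, hj₁ ▸ hm, hj₁ ▸ hm', he⟩, ?_⟩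
      intro j hj
      obtain rfl : j₁ = j := by simpa [hj₁] using hj
      exact he
    | succ i ih =>
      intro hi
      obtain ⟨ih1, ih3⟩ := ih (by omega)
      obtain ⟨j, hj⟩ := hy i (by omega)
      obtain ⟨j', hj'⟩ := hy (i + 1) hi
      have h1 := ih3 j hj
      have h2 := sign (by omega) hj hj'
      have h3 := hne (i + 1) hi
      have h4 : b j' = (e ^^ (N (i + 1 + 1)).isLeft) := by
        revert h1 h2 h3
        cases b j <;> cases b j' <;> cases e <;> cases (N (i + 1)).isLeft <;>
          cases (N (i + 1 + 1)).isLeft <;> simp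
      refine ⟨ih1.tail ⟨h3, j', hj' ▸ hN2 (i + 1) (by omega), hj' ▸ hN1 _ hi, h4⟩, ?_⟩
      intro k hk
      obtain rfl : j' = k := by simpa [hj'] using hk
      exact h4
  obtain ⟨r, rfl⟩ : ∃ r, q = r + 2 := ⟨q - 2, by omega⟩
  obtain ⟨h1, h3⟩ := key r (by omega)
  have hm := hN1 0 (by omega)
  have hm' := hN2 (r + 1) (by omega)
  rw [hw] at hm
  -- Alternation is not required where the loop closes. If the last and first edges are on the same
  -- side, their components share `w 0` and coincide; otherwise `w 0` is a `y` and supplies one more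
  -- arc.
  by_cases hs : (N (r + 1)).isLeft = (N 0).isLeft
  · refine ⟨e, N 0, ?_⟩
    rwa [hm'.unique hm hs] at h1
  · obtain ⟨j, hj⟩ := exists_eq_y_of_ne hm' hm hs
    obtain ⟨j', hj'⟩ := hy r (by omega)
    refine ⟨e, N 0, h1.tail ⟨hs, j, hj ▸ hm', hj ▸ hm, ?_⟩⟩
    have h4 := h3 j' hj'
    have h5 := sign (by omega) hj' hj
    revert h4 h5 hs
    cases b j <;> cases b j' <;> cases e <;> cases (N (r + 1)).isLeft <;>
      cases (N 0).isLeft <;> simp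

end Loops

/-! ### Functors of mixed variance, and the composite without cycles -/

section Composition

variable {A : Type u} [Category.{v} A]

/-- `f` in case of the sign `1`, `g` in case of the sign `-1`; each of them is needed in its own
case only. -/
def Var.hom : (s : Bool) → {X X' Y Y' : A} → (s = true → (X ⟶ X')) → (s = false → (Y' ⟶ Y)) →
    (Var.obj s X Y ⟶ Var.obj s X' Y')
  | true, _, _, _, _, f, _ => f rfl
  | false, _, _, _, _, _, g => (g rfl).op

theorem Var.map_eq_hom : ∀ (s : Bool) {X X' Y Y' : A} (f : X ⟶ X') (g : Y' ⟶ Y),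
    Var.map s f g = Var.hom s (fun _ => f) (fun _ => g)
  | true, _, _, _, _, _, _ => rfl
  | false, _, _, _, _, _, _ => rfl

theorem Var.hom_comp : ∀ (s : Bool) {X X' X'' Y Y' Y'' : A} (f : s = true → (X ⟶ X'))
    (g : s = false → (Y' ⟶ Y)) (f' : s = true → (X' ⟶ X'')) (g' : s = false → (Y'' ⟶ Y')),
    Var.hom s f g ≫ Var.hom s f' g' = Var.hom s (fun h => f h ≫ f' h) (fun h => g' h ≫ g h)
  | true, _, _, _, _, _, _, _, _, _, _ => rfl
  | false, _, _, _, _, _, _, _, _, _, _ => rfl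

theorem Var.hom_id : ∀ (s : Bool) (X Y : A),
    Var.hom s (fun _ => 𝟙 X) (fun _ => 𝟙 Y) = 𝟙 (Var.obj s X Y)
  | true, _, _ => rfl
  | false, _, _ => rfl

variable {m n p : ℕ} {a : Fin m → Bool} {b : Fin n → Bool} {c : Fin p → Bool}

/-- The action of a functor of mixed variance on morphisms of which each is needed for one of the
signs only. -/
def MFunctor.hmap (T : MFunctor A a) {X X' Y Y' : Fin m → A} (f : ∀ i, a i = true → (X i ⟶ X' i))
    (g : ∀ i, a i = false → (Y' i ⟶ Y i)) : T.mobj X Y ⟶ T.mobj X' Y' :=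
  CategoryTheory.Functor.map T (X := fun i => Var.obj (a i) (X i) (Y i))
    (Y := fun i => Var.obj (a i) (X' i) (Y' i)) (fun i => Var.hom (a i) (f i) (g i))

theorem MFunctor.mmap_eq_hmap (T : MFunctor A a) {X X' Y Y' : Fin m → A} (f : ∀ i, X i ⟶ X' i)
    (g : ∀ i, Y' i ⟶ Y i) : T.mmap f g = T.hmap (fun i _ => f i) (fun i _ => g i) := by
  simp only [MFunctor.mmap, MFunctor.hmap, Var.map_eq_hom]

theorem MFunctor.hmap_comp (T : MFunctor A a) {X X' X'' Y Y' Y'' : Fin m → A}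
    (f : ∀ i, a i = true → (X i ⟶ X' i)) (g : ∀ i, a i = false → (Y' i ⟶ Y i))
    (f' : ∀ i, a i = true → (X' i ⟶ X'' i)) (g' : ∀ i, a i = false → (Y'' i ⟶ Y' i)) :
    T.hmap f g ≫ T.hmap f' g' = T.hmap (fun i h => f i h ≫ f' i h) (fun i h => g' i h ≫ g i h) := by
  simp only [MFunctor.hmap]
  rw [← CategoryTheory.Functor.map_comp]
  congr 1
  funext i
  exact Var.hom_comp _ _ _ _ _

theorem MFunctor.hmap_id (T : MFunctor A a) (X Y : Fin m → A) :
    T.hmap (fun i _ => 𝟙 (X i)) (fun i _ => 𝟙 (Y i)) = 𝟙 (T.mobj X Y) := by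
  simp only [MFunctor.hmap, Var.hom_id]
  exact CategoryTheory.Functor.map_id _ _

section Flip

variable {J : Type} [Category.{0} J] (D : J ⥤ A)

/-- `MFunctor.hmap` for the images of morphisms of a thin category. -/
def MFunctor.tmap (T : MFunctor A a) {X X' Y Y' : Fin m → J}
    (f : ∀ i, a i = true → (X i ⟶ X' i)) (g : ∀ i, a i = false → (Y' i ⟶ Y i)) :
    T.mobj (fun i => D.obj (X i)) (fun i => D.obj (Y i)) ⟶
      T.mobj (fun i => D.obj (X' i)) (fun i => D.obj (Y' i)) :=
  T.hmap (fun i h => D.map (f i h)) (fun i h => D.map (g i h))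

theorem MFunctor.tmap_eq_mmap (T : MFunctor A a) {X X' Y Y' : Fin m → J}
    {f : ∀ i, a i = true → (X i ⟶ X' i)} {g : ∀ i, a i = false → (Y' i ⟶ Y i)}
    {f' : ∀ i, D.obj (X i) ⟶ D.obj (X' i)} {g' : ∀ i, D.obj (Y' i) ⟶ D.obj (Y i)}
    (hf : ∀ i h, D.map (f i h) = f' i) (hg : ∀ i h, D.map (g i h) = g' i) :
    T.tmap D f g = T.mmap f' g' := by
  rw [tmap, mmap_eq_hmap]
  simp only [hf, hg]

variable [Quiver.IsThin J]

theorem MFunctor.tmap_comp (T : MFunctor A a) {X X' X'' Y Y' Y'' : Fin m → J}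
    (f : ∀ i, a i = true → (X i ⟶ X' i)) (g : ∀ i, a i = false → (Y' i ⟶ Y i))
    (f' : ∀ i, a i = true → (X' i ⟶ X'' i)) (g' : ∀ i, a i = false → (Y'' i ⟶ Y' i))
    (f'' : ∀ i, a i = true → (X i ⟶ X'' i)) (g'' : ∀ i, a i = false → (Y'' i ⟶ Y i)) :
    T.tmap D f g ≫ T.tmap D f' g' = T.tmap D f'' g'' := by
  rw [tmap, tmap, hmap_comp, tmap]
  congr 1 <;> funext i h <;> rw [← D.map_comp] <;> exact congrArg _ (Subsingleton.elim _ _)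

/-- A g-dinatural transformation gives the same morphism before and after one of its components is
moved from the source to the target of a morphism. -/
theorem IsGDinatural.tmap_eq {Γ : SignedGraph a b} {T : MFunctor A a} {S : MFunctor A b}
    {α : Transf Γ T S} (hα : IsGDinatural Γ T S α) (k : Γ.Comp) {P P' : Γ.Comp → J}
    (h : ∀ j, P j ⟶ P' j) (hk : ∀ j, j ≠ k → P j = P' j)
    {s s' : Fin m → J} {t t' : Fin n → J}
    (f₁ : ∀ i, a i = true → (s i ⟶ P (Γ.π (.left i))))
    (f₂ : ∀ i, a i = false → (P (Γ.π (.left i)) ⟶ s' i))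
    (f₁' : ∀ i, a i = true → (s i ⟶ P' (Γ.π (.left i))))
    (f₂' : ∀ i, a i = false → (P' (Γ.π (.left i)) ⟶ s' i))
    (g₁ : ∀ j, b j = true → (P (Γ.π (.right j)) ⟶ t j))
    (g₂ : ∀ j, b j = false → (t' j ⟶ P (Γ.π (.right j))))
    (g₁' : ∀ j, b j = true → (P' (Γ.π (.right j)) ⟶ t j))
    (g₂' : ∀ j, b j = false → (t' j ⟶ P' (Γ.π (.right j)))) :
    T.tmap D f₁ f₂ ≫ α (fun j => D.obj (P j)) ≫ S.tmap D g₁ g₂ =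
      T.tmap D f₁' f₂' ≫ α (fun j => D.obj (P' j)) ≫ S.tmap D g₁' g₂' := by
  have hex := hα k (fun j => D.obj (P j)) (fun j => D.obj (P' j)) (fun j => D.map (h j)) (by
    intro j hj
    refine ⟨congrArg D.obj (hk j hj), ?_⟩
    rw [Subsingleton.elim (h j) (eqToHom (hk j hj)), eqToHom_map])
  -- Both sides factor through the hexagon, with the common outer maps given by `f₁`, `f₂'` before
  -- it and `g₁'`, `g₂` after it. Thinness makes the factorizations automatic.
  simp only [MFunctor.mmap_eq_hmap, ← D.map_id] at hex
  have e₁ := MFunctor.tmap_comp D T f₁ f₂' (fun i _ => 𝟙 _) (fun i _ => h _) f₁ f₂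
  have e₂ := MFunctor.tmap_comp D T f₁ f₂' (fun i _ => h _) (fun i _ => 𝟙 _) f₁' f₂'
  have e₃ := MFunctor.tmap_comp D S (fun i _ => h _) (fun i _ => 𝟙 _) g₁' g₂ g₁ g₂
  have e₄ := MFunctor.tmap_comp D S (fun i _ => 𝟙 _) (fun i _ => h _) g₁' g₂ g₁' g₂'
  rw [← e₁, ← e₂, ← e₃, ← e₄]
  simp only [Category.assoc]
  congr 1
  have := congrArg (· ≫ S.tmap D g₁' g₂) hex
  simp only [Category.assoc] at this
  exact this.symm

end Flip

instance {I : Type} : Quiver.IsThin (Σ _ : I, Fin 2) := fun X Y => by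
  constructor
  rintro ⟨f⟩ ⟨g⟩
  rw [Subsingleton.elim f g]

variable {Φ : SignedGraph a b} {Ψ : SignedGraph b c}

/-- The components of `Φ` and `Ψ` that have been moved to the target satisfy the condition for the
transformations to be composable. -/
def Composable (p : Φ.Comp → Fin 2) (q : Ψ.Comp → Fin 2) : Prop :=
  ∀ j, (b j = true → p (Φ.π (.right j)) ≤ q (Ψ.π (.left j))) ∧
    (b j = false → q (Ψ.π (.left j)) ≤ p (Φ.π (.right j)))

variable {F : MFunctor A a} {G : MFunctor A b} {H : MFunctor A c}

/-- The morphisms of the disjoint union of copies of `0 ⟶ 1`. -/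
abbrev arrow {I : Type} (i : I) {x y : Fin 2} (h : x ≤ y) :
    (⟨i, x⟩ : Σ _ : I, Fin 2) ⟶ ⟨i, y⟩ :=
  Sigma.SigmaHom.mk (homOfLE h)

variable (D : (Σ _ : (comp Φ Ψ).Comp, Fin 2) ⥤ A) (α : Transf Φ F G) (β : Transf Ψ G H)

/-- The composition of `α` and `β` in which the components given by `p` and `q` have been moved to
the target. -/
noncomputable def composite (p : Φ.Comp → Fin 2) (q : Ψ.Comp → Fin 2) (h : Composable p q) :=
  F.tmap D (X := fun i => ⟨(comp Φ Ψ).π (.left i), 0⟩) (Y := fun i => ⟨(comp Φ Ψ).π (.left i), 1⟩)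
    (X' := fun i => ⟨compOfFst Φ Ψ (Φ.π (.left i)), p (Φ.π (.left i))⟩)
    (Y' := fun i => ⟨compOfFst Φ Ψ (Φ.π (.left i)), p (Φ.π (.left i))⟩)
    (fun _ _ => arrow _ (Fin.zero_le _)) (fun _ _ => arrow _ (Fin.le_last _)) ≫
  α (fun k => D.obj ⟨compOfFst Φ Ψ k, p k⟩) ≫
  G.tmap D (X := fun j => ⟨compOfFst Φ Ψ (Φ.π (.right j)), p (Φ.π (.right j))⟩)
    (Y := fun j => ⟨compOfFst Φ Ψ (Φ.π (.right j)), p (Φ.π (.right j))⟩)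
    (X' := fun j => ⟨compOfSnd Φ Ψ (Ψ.π (.left j)), q (Ψ.π (.left j))⟩)
    (Y' := fun j => ⟨compOfSnd Φ Ψ (Ψ.π (.left j)), q (Ψ.π (.left j))⟩)
    -- Both component labels at `y j` reduce to `toCompVertex` of `.y j`, so no transport is needed.
    (fun j hj => arrow (compOfFst Φ Ψ (Φ.π (.right j))) ((h j).1 hj))
    (fun j hj => arrow (compOfFst Φ Ψ (Φ.π (.right j))) ((h j).2 hj)) ≫
  β (fun k => D.obj ⟨compOfSnd Φ Ψ k, q k⟩) ≫
  H.tmap D (X := fun k => ⟨compOfSnd Φ Ψ (Ψ.π (.right k)), q (Ψ.π (.right k))⟩)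
    (Y := fun k => ⟨compOfSnd Φ Ψ (Ψ.π (.right k)), q (Ψ.π (.right k))⟩)
    (X' := fun k => ⟨(comp Φ Ψ).π (.right k), 1⟩) (Y' := fun k => ⟨(comp Φ Ψ).π (.right k), 0⟩)
    (fun _ _ => arrow _ (Fin.le_last _)) (fun _ _ => arrow _ (Fin.zero_le _))

variable {α β}

theorem composite_eq_of_le_fst (hα : IsGDinatural Φ F G α) {p p' : Φ.Comp → Fin 2}
    {q : Ψ.Comp → Fin 2} (h : Composable p q) (h' : Composable p' q) (k : Φ.Comp)
    (hle : p ≤ p') (hk : ∀ j, j ≠ k → p j = p' j) :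
    composite D α β p q h = composite D α β p' q h' := by
  have := hα.tmap_eq D k (P := fun k => ⟨compOfFst Φ Ψ k, p k⟩)
    (P' := fun k => ⟨compOfFst Φ Ψ k, p' k⟩) (s := fun i => ⟨(comp Φ Ψ).π (.left i), 0⟩)
    (s' := fun i => ⟨(comp Φ Ψ).π (.left i), 1⟩)
    (t := fun j => ⟨compOfSnd Φ Ψ (Ψ.π (.left j)), q (Ψ.π (.left j))⟩)
    (t' := fun j => ⟨compOfSnd Φ Ψ (Ψ.π (.left j)), q (Ψ.π (.left j))⟩)
    (fun j => arrow _ (hle j)) (fun j hj => by rw [hk j hj])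
    (fun _ _ => arrow _ (Fin.zero_le _)) (fun _ _ => arrow _ (Fin.le_last _))
    (fun _ _ => arrow _ (Fin.zero_le _)) (fun _ _ => arrow _ (Fin.le_last _))
    (fun j hj => arrow (compOfFst Φ Ψ (Φ.π (.right j))) ((h j).1 hj))
    (fun j hj => arrow (compOfFst Φ Ψ (Φ.π (.right j))) ((h j).2 hj))
    (fun j hj => arrow (compOfFst Φ Ψ (Φ.π (.right j))) ((h' j).1 hj))
    (fun j hj => arrow (compOfFst Φ Ψ (Φ.π (.right j))) ((h' j).2 hj))
  unfold composite
  simp only [← Category.assoc] at this ⊢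
  rw [this]

theorem composite_eq_of_le_snd (hβ : IsGDinatural Ψ G H β) {p : Φ.Comp → Fin 2}
    {q q' : Ψ.Comp → Fin 2} (h : Composable p q) (h' : Composable p q') (l : Ψ.Comp)
    (hle : q ≤ q') (hl : ∀ j, j ≠ l → q j = q' j) :
    composite D α β p q h = composite D α β p q' h' := by
  have := hβ.tmap_eq D l (P := fun k => ⟨compOfSnd Φ Ψ k, q k⟩)
    (P' := fun k => ⟨compOfSnd Φ Ψ k, q' k⟩)
    (s := fun j => ⟨compOfFst Φ Ψ (Φ.π (.right j)), p (Φ.π (.right j))⟩)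
    (s' := fun j => ⟨compOfFst Φ Ψ (Φ.π (.right j)), p (Φ.π (.right j))⟩)
    (t := fun i => ⟨(comp Φ Ψ).π (.right i), 1⟩)
    (t' := fun i => ⟨(comp Φ Ψ).π (.right i), 0⟩)
    (fun j => arrow _ (hle j)) (fun j hj => by rw [hl j hj])
    (fun j hj => arrow (compOfFst Φ Ψ (Φ.π (.right j))) ((h j).1 hj))
    (fun j hj => arrow (compOfFst Φ Ψ (Φ.π (.right j))) ((h j).2 hj))
    (fun j hj => arrow (compOfFst Φ Ψ (Φ.π (.right j))) ((h' j).1 hj))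
    (fun j hj => arrow (compOfFst Φ Ψ (Φ.π (.right j))) ((h' j).2 hj))
    (fun _ _ => arrow _ (Fin.le_last _)) (fun _ _ => arrow _ (Fin.zero_le _))
    (fun _ _ => arrow _ (Fin.le_last _)) (fun _ _ => arrow _ (Fin.zero_le _))
  unfold composite
  rw [this]

/-- The inequality that a `y` imposes goes from `Φ` to `Ψ` or back according to its sign, just as
the direction of its arc does. -/
theorem composable_iff (e : Φ.Comp ⊕ Ψ.Comp → Fin 2) :
    Composable (fun k => e (.inl k)) (fun l => e (.inr l)) ↔
      ∀ u v, Precedes false u v → e v ≤ e u := by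
  constructor
  · rintro h (k | l) (k' | l') ⟨hs, j, h1, h2, h3⟩ <;> simp at hs h3
    · rw [← mem_inl_y.1 h1, ← mem_inr_y.1 h2]
      exact (h j).2 h3
    · rw [← mem_inr_y.1 h1, ← mem_inl_y.1 h2]
      exact (h j).1 h3
  · intro h j
    refine ⟨fun hj => h _ _ ⟨by simp, j, mem_inr_y.2 rfl, mem_inl_y.2 rfl, by simpa⟩,
      fun hj => h _ _ ⟨by simp, j, mem_inl_y.2 rfl, mem_inr_y.2 rfl, by simpa⟩⟩

theorem composite_eq_last (hα : IsGDinatural Φ F G α) (hβ : IsGDinatural Ψ G H β)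
    (hacyc : ∀ u : Φ.Comp ⊕ Ψ.Comp, ¬ Relation.TransGen (Precedes false) u u)
    (e : Φ.Comp ⊕ Ψ.Comp → Fin 2)
    (h : Composable (fun k => e (.inl k)) (fun l => e (.inr l))) :
    composite D α β _ _ h = composite D α β (fun _ => 1) (fun _ => 1) fun _ => by simp := by
  classical
  have : Finite (Vertex m n Φ.G) := by
    have := finite_amalgVertex Φ Ψ
    exact Finite.of_injective _ (inFst (p := p) (H := Ψ.G)).injective
  have : Finite (Vertex n p Ψ.G) := by
    have := finite_amalgVertex Φ Ψ
    exact Finite.of_injective _ (inSnd (m := m) (G := Φ.G)).injective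
  have hwf : WellFounded (Relation.TransGen (Precedes (Φ := Φ) (Ψ := Ψ) false)) := by
    have : Std.Irrefl (Relation.TransGen (Precedes (Φ := Φ) (Ψ := Ψ) false)) := ⟨hacyc⟩
    exact Finite.wellFounded_of_trans_of_irrefl _
  -- The stages only grow, and there are finitely many assignments.
  induction e using WellFoundedGT.induction with
  | ind e ih =>
  by_cases he : ∀ u, e u = 1
  · obtain rfl : e = fun _ => 1 := funext he
    rfl
  · push Not at he
    obtain ⟨u, hu, hmin⟩ := hwf.has_min {u | e u ≠ 1} he
    have hlt : e < Function.update e u 1 := by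
      rw [lt_update_self_iff]
      exact lt_of_le_of_ne (Fin.le_last _) hu
    have h' : Composable (fun k => Function.update e u 1 (.inl k))
        (fun l => Function.update e u 1 (.inr l)) := by
      rw [composable_iff] at h ⊢
      intro v w hvw
      have h1 := h v w hvw
      rcases eq_or_ne v u with rfl | hv
      · rw [Function.update_self]
        exact Fin.le_last _
      rw [Function.update_of_ne hv]
      rcases eq_or_ne w u with rfl | hw
      -- By minimality of the raised component, every predecessor already has stage 1.
      · have : e v = 1 := not_not.1 fun hne => hmin v hne (.single hvw)
        rw [this]
        exact Fin.le_last _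
      · rwa [Function.update_of_ne hw]
    rw [← ih _ hlt h']
    rcases u with k | l
    · have hq : (fun l : Ψ.Comp => Function.update e (.inl k) 1 (.inr l)) = fun l => e (.inr l) := by
        simp
      revert h'
      rw [hq]
      intro h'
      refine composite_eq_of_le_fst D hα h h' k (fun j => hlt.le _) fun j hj => ?_
      rw [Function.update_of_ne (by simpa)]
    · have hq : (fun k : Φ.Comp => Function.update e (.inr l) 1 (.inl k)) = fun k => e (.inl k) := by
        simp
      revert h'
      rw [hq]
      intro h'
      refine composite_eq_of_le_snd D hβ h h' l (fun j => hlt.le _) fun j hj => ?_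
      rw [Function.update_of_ne (by simpa)]

theorem isGDinatural_compTransf (hα : IsGDinatural Φ F G α) (hβ : IsGDinatural Ψ G H β)
    (hacyc : ∀ u : Φ.Comp ⊕ Ψ.Comp, ¬ Relation.TransGen (Precedes false) u u) :
    IsGDinatural (comp Φ Ψ) F H (compTransf Φ Ψ α β) := by
  intro _ X Y f _
  -- One arrow `X k ⟶ Y k` for every component of `ΨΦ`; all of them are treated at once.
  let D : (Σ _ : (comp Φ Ψ).Comp, Fin 2) ⥤ A := Sigma.desc fun k => ComposableArrows.mk₁ (f k)
  have key := composite_eq_last D hα hβ hacyc (fun _ => 0) (fun _ => by simp)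
  have mid : ∀ x : Fin 2, G.tmap D (X := fun j => ⟨compOfFst Φ Ψ (Φ.π (.right j)), x⟩)
      (Y := fun j => ⟨compOfFst Φ Ψ (Φ.π (.right j)), x⟩)
      (X' := fun j => ⟨compOfFst Φ Ψ (Φ.π (.right j)), x⟩)
      (Y' := fun j => ⟨compOfFst Φ Ψ (Φ.π (.right j)), x⟩)
      (fun j _ => arrow (compOfFst Φ Ψ (Φ.π (.right j))) le_rfl)
      (fun j _ => arrow (compOfFst Φ Ψ (Φ.π (.right j))) le_rfl) = 𝟙 _ := by
    intro x
    refine Eq.trans ?_ (G.hmap_id _ _)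
    rw [MFunctor.tmap]
    congr 1 <;> funext j _ <;> exact D.map_id _
  have assoc : ∀ {U V W Z T : A} {s s' : U ⟶ V} {f : V ⟶ W} {i : W ⟶ W} {g : W ⟶ Z} {t t' : Z ⟶ T},
      s = s' → i = 𝟙 W → t = t' → s ≫ f ≫ i ≫ g ≫ t = s' ≫ (f ≫ g) ≫ t' := by
    rintro _ _ _ _ _ _ _ _ _ _ _ _ rfl rfl rfl
    simp
  refine Eq.trans (Eq.symm ?_) (key.symm.trans ?_)
  · exact assoc (F.tmap_eq_mmap D (fun _ _ => rfl) fun _ _ => D.map_id _) (mid 1)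
      (H.tmap_eq_mmap D (fun _ _ => D.map_id _) fun _ _ => rfl)
  · exact assoc (F.tmap_eq_mmap D (fun _ _ => D.map_id _) fun _ _ => rfl) (mid 0)
      (H.tmap_eq_mmap D (fun _ _ => rfl) fun _ _ => D.map_id _)

end Composition

/-! ### A composite that fails to be g-dinatural when there is a cycle -/

section Counterexample

/-- Subsets of `Bool`, as objects of a category in arbitrary universes. -/
structure BoolSet : Type u where
  set : Set Bool

instance : Category.{v} BoolSet.{u} where
  Hom S T := ULift.{v} (S.set → T.set)
  id _ := ⟨id⟩
  comp f g := ⟨g.down ∘ f.down⟩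

/-- The set in an argument place of any sign is nonempty. -/
def IsInhabited : (s : Bool) → Var BoolSet.{u} s → Prop
  | true, S => S.set.Nonempty
  | false, S => S.unop.set.Nonempty

theorem BoolSet.nonempty_of_hom {S T : BoolSet.{u}} (f : S ⟶ T) (h : S.set.Nonempty) :
    T.set.Nonempty :=
  ⟨_, (f.down ⟨_, h.choose_spec⟩).2⟩

theorem IsInhabited.map : ∀ {s : Bool} {W W' : Var BoolSet.{u} s} (_ : W ⟶ W'),
    s = true → IsInhabited s W → IsInhabited s W'
  | true, _, _, f, _, h => BoolSet.nonempty_of_hom f h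

theorem IsInhabited.comap : ∀ {s : Bool} {W W' : Var BoolSet.{u} s} (_ : W ⟶ W'),
    s = false → IsInhabited s W' → IsInhabited s W
  | false, _, _, f, _, h => BoolSet.nonempty_of_hom f.unop h

theorem isInhabited_obj : ∀ (s : Bool) (S T : BoolSet.{u}),
    IsInhabited s (Var.obj s S T) ↔ ((if s then S else T).set.Nonempty)
  | true, _, _ => Iff.rfl
  | false, _, _ => Iff.rfl

variable {m n p : ℕ} {a : Fin m → Bool} {b : Fin n → Bool} {c : Fin p → Bool}

/-- Inhabitation is passed on along the edges of `Φ` between argument places `y`, from the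
negative one to the positive one. -/
def Passes (Φ : SignedGraph a b) (W : ∀ j, Var BoolSet.{u} (b j)) : Prop :=
  ∀ j j', b j = false → b j' = true → Φ.π (.right j) = Φ.π (.right j') →
    IsInhabited _ (W j) → IsInhabited _ (W j')

theorem Passes.map {Φ : SignedGraph a b} {W W' : ∀ j, Var BoolSet.{u} (b j)} (f : W ⟶ W')
    (h : Passes Φ W) : Passes Φ W' := fun j j' hj hj' he hW =>
  (h j j' hj hj' he (hW.comap (f j) hj)).map (f j') hj'

/-- The functor that takes the value `{true}` if inhabitation is passed on, and `∅` otherwise. -/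
def passes (Φ : SignedGraph a b) : MFunctor BoolSet.{u} b where
  obj W := ⟨{x | x = true ∧ Passes Φ W}⟩
  map f := ⟨fun x => ⟨x.1, x.2.1, x.2.2.map f⟩⟩

/-- The functor with the constant value `{true}`. -/
abbrev point : MFunctor BoolSet.{u} a := (Functor.const _).obj ⟨{true}⟩

/-- The functor with the constant value `Bool`. -/
abbrev truth : MFunctor BoolSet.{u} c := (Functor.const _).obj ⟨Set.univ⟩

/-- The transformation from the point given by the fact that inhabitation is passed on. -/
def passesPoint (Φ : SignedGraph a b) : Transf Φ (point (a := a)) (passes.{u, v} Φ) := fun X =>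
  ⟨fun x => ⟨x.1, x.2, fun j j' hj hj' he h => by
    rw [isInhabited_obj] at h ⊢
    simp only [ite_self] at h ⊢
    rwa [← he]⟩⟩

open Classical in
/-- The truth value of inhabitation in the component `l`. -/
noncomputable def inhabitation (Φ : SignedGraph a b) (Ψ : SignedGraph b c) (l : Ψ.Comp) :
    Transf Ψ (passes.{u, v} Φ) (truth (c := c)) := fun X =>
  ⟨fun _ => ⟨decide (X l).set.Nonempty, trivial⟩⟩

theorem isGDinatural_passesPoint (Φ : SignedGraph a b) :
    IsGDinatural Φ point (passes.{u, v} Φ) (passesPoint Φ) := by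
  intro k X Y f _
  apply ULift.ext
  funext x
  exact Subtype.ext rfl

theorem isGDinatural_inhabitation {Φ : SignedGraph a b} {Ψ : SignedGraph b c} {l : Ψ.Comp}
    (hl : Relation.TransGen (Precedes (Φ := Φ) true) (.inr l) (.inr l)) :
    IsGDinatural Ψ (passes.{u, v} Φ) truth (inhabitation Φ Ψ l) := by
  intro k X Y f _
  apply ULift.ext
  funext x
  refine Subtype.ext (decide_eq_decide.2 ⟨fun h => ?_, BoolSet.nonempty_of_hom (f l)⟩)
  -- The element `x` lives at the start of the hexagon, where positive places hold `X` and negative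
  -- ones hold `Y`.
  have hp : ∀ j j', b j = false → b j' = true → Φ.π (.right j) = Φ.π (.right j') →
      (Y (Ψ.π (.left j))).set.Nonempty → (X (Ψ.π (.left j'))).set.Nonempty := by
    intro j j' hj hj' he hY
    have := x.2.2 j j' hj hj' he
    simpa [isInhabited_obj, hj, hj', hY] using this
  -- The property carried along the cycle: a component of `Φ` has it once it is entered by a
  -- negative `y` from an inhabited component of `Ψ`.
  let Q : Φ.Comp ⊕ Ψ.Comp → Prop
    | .inl k => ∃ j, b j = false ∧ Φ.π (.right j) = k ∧ (Y (Ψ.π (.left j))).set.Nonempty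
    | .inr l => (Y l).set.Nonempty
  have back : ∀ k l, Precedes true (.inl k) (.inr l) → Q (.inl k) → (X l).set.Nonempty := by
    rintro k l ⟨-, j', h1, h2, h3⟩ ⟨j, hj, rfl, hY⟩
    rw [← mem_inr_y.1 h2]
    exact hp j j' hj (by simpa using h3) (mem_inl_y.1 h1).symm hY
  have step : ∀ u v, Precedes true u v → Q u → Q v := by
    rintro (k | l) (k' | l') huv hu
    · simp [Precedes] at huv
    · exact BoolSet.nonempty_of_hom (f l') (back k l' huv hu)
    · obtain ⟨-, j, h1, h2, h3⟩ := huv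
      refine ⟨j, by simpa using h3, mem_inl_y.1 h2, ?_⟩
      rw [mem_inr_y.1 h1]
      exact hu
    · simp [Precedes] at huv
  -- The last arc is split off because it must end with inhabitation of `X l`; elsewhere `f` is
  -- applied to return to `Y`.
  obtain ⟨w, hw, hwl⟩ := Relation.TransGen.tail'_iff.1 hl
  have hQ : Q w := by
    clear hwl
    induction hw with
    | refl => exact h
    | tail _ h ih => exact step _ _ h ih
  rcases w with k' | l'
  · exact back k' l hwl hQ
  · simp [Precedes] at hwl

theorem not_providesGDinaturality_of_precedes {Φ : SignedGraph a b} {Ψ : SignedGraph b c}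
    {l : Ψ.Comp} (hl : Relation.TransGen (Precedes (Φ := Φ) true) (.inr l) (.inr l)) :
    ¬ ProvidesGDinaturality.{v, u} Φ Ψ := by
  classical
  intro hprov
  have h := hprov BoolSet.{u} point (passes.{u, v} Φ) truth (passesPoint Φ) (inhabitation Φ Ψ l)
    (isGDinatural_passesPoint Φ) (isGDinatural_inhabitation hl)
  let k := compOfSnd Φ Ψ l
  -- Empty at `k` and equal to `{true}` elsewhere, so that `X` and `Y` differ only at `k`, the
  -- component containing `l`.
  let X : (comp Φ Ψ).Comp → BoolSet.{u} := fun j => ⟨{x | x = true ∧ j ≠ k}⟩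
  let Y : (comp Φ Ψ).Comp → BoolSet.{u} := fun _ => ⟨{true}⟩
  have h := h k X Y (fun j => ⟨fun x => ⟨x.1, x.2.1⟩⟩) (by
    intro j hj
    have hXY : X j = Y j := by simp [X, Y, hj]
    refine ⟨hXY, ?_⟩
    apply ULift.ext
    funext x
    apply Subtype.ext
    exact x.2.1.trans (Subtype.prop (ULift.down (eqToHom hXY) x)).symm)
  -- Evaluated at the point `true`, the two sides of the hexagon are the truth values for `Y k` and
  -- `X k`.
  have h1 := congrArg (fun g => (ULift.down g ⟨true, rfl⟩).1) h
  have h2 : decide (Y k).set.Nonempty = decide (X k).set.Nonempty := by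
    exact h1
  simp [X, Y] at h2

end Counterexample

/-! ### Cycles through a component of the second graph -/

section Cycle

variable {m n p : ℕ} {a : Fin m → Bool} {b : Fin n → Bool} {c : Fin p → Bool}
variable {Φ : SignedGraph a b} {Ψ : SignedGraph b c}

/-- Every cycle of components passes through a component of `Ψ`. -/
theorem exists_cycle_inr {d : Bool} {u : Φ.Comp ⊕ Ψ.Comp}
    (h : Relation.TransGen (Precedes d) u u) :
    ∃ l : Ψ.Comp, Relation.TransGen (Precedes (Φ := Φ) d) (.inr l) (.inr l) := by
  rcases u with k | l
  · obtain ⟨w, hw, hwk⟩ := Relation.TransGen.head'_iff.1 h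
    rcases w with k' | l
    · simp [Precedes] at hw
    · exact ⟨l, Relation.TransGen.tail' hwk hw⟩
  · exact ⟨l, h⟩

end Cycle

end GDinat

theorem theorem2p2 {m n p : ℕ} {a : Fin m → Bool} {b : Fin n → Bool} {c : Fin p → Bool}
    (Φ : GDinat.SignedGraph a b) (Ψ : GDinat.SignedGraph b c)
    (hΦ : Φ.IsGraph) (hΨ : Ψ.IsGraph) :
    GDinat.ProvidesGDinaturality.{v, u} Φ Ψ ↔ ¬ GDinat.HasAlternatingLoop Φ Ψ := by
  constructor
  · intro h hloop
    obtain ⟨u, hu⟩ := GDinat.exists_precedes_of_hasAlternatingLoop hΦ hΨ hloop true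
    obtain ⟨l, hl⟩ := GDinat.exists_cycle_inr hu
    exact GDinat.not_providesGDinaturality_of_precedes hl h
  · intro h A _ F G H γ δ hγ hδ
    exact GDinat.isGDinatural_compTransf hγ hδ fun u hu =>
      h (GDinat.hasAlternatingLoop_of_precedes hΦ hΨ hu)
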